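/- Let $\mathbf B=\{z=(z_j)_{j\ge 1}\in\mathbb C^{\mathbb N}:\ |z_j|<1 \text{ for all } j,\ z_j\to 0\}$ be the open unit ball of the Banach space $\mathbf c_0$ of complex null sequences (with the sup norm). Let $A^+(\mathbb T^\infty)$ be the algebra, under pointwise operations, of the functions $f(z)=\sum_{\alpha} a_\alpha z^\alpha$ on $\mathbf B$, where $\alpha$ runs over the finitely supported sequences of non-negative integers, $z^\alpha=\prod_j z_j^{\alpha_j}$, and $\|f\|:=\sum_\alpha |a_\alpha|<\infty$. Let $\phi=(\phi_j)_j:\mathbf B\to\mathbf B$ be an analytic map which induces a composition operator $C_\phi$ on $A^+(\mathbb T^\infty)$, i.e. $C_\phi f:=f\circ\phi\in A^+(\mathbb T^\infty)$ for every $f\in A^+(\mathbb T^\infty)$. If $C_\phi$ is an isometric automorphism of $A^+(\mathbb T^\infty)$ (that is, $C_\phi$ is bijective and $\|C_\phi f\|=\|f\|$ for all $f$), then there are a permutation $\sigma$ of $\mathbb N$ and complex numbers $\epsilon_j$ with $|\epsilon_j|=1$ such that $\phi(z)=(\epsilon_j z_{\sigma(j)})_{j}$ for all $z\in\mathbf B$.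 -/

import Mathlib

noncomputable section

/-- The Banach space `c₀` of complex sequences tending to zero at infinity, with the norm
`‖z‖ = sup_j |z_j|`: continuous functions vanishing at infinity on the discrete space `ℕ`. -/
abbrev CZero : Type := ZeroAtInftyContinuousMap ℕ ℂ

/-- The open unit ball `𝐁` of `c₀`. -/
def ballB : Set CZero := Metric.ball (0 : CZero) 1

theorem CZero.norm_coord_le (z : CZero) (j : ℕ) : ‖z j‖ ≤ ‖z‖ :=
  z.toBCF.norm_coe_le_norm j

theorem norm_coord_lt_one (z : ballB) (j : ℕ) : ‖z.1 j‖ < 1 :=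
  (z.1.norm_coord_le j).trans_lt (by simpa [ballB] using z.2)

/-- `𝐁 = 𝔻^∞ ∩ c₀`. -/
theorem mem_ballB_iff (z : CZero) : z ∈ ballB ↔ ∀ j, ‖z j‖ < 1 := by
  refine ⟨fun h j => norm_coord_lt_one ⟨z, h⟩ j, fun h => ?_⟩
  have h0 : Filter.Tendsto (fun j => ‖z j‖) Filter.cofinite (nhds 0) := by
    have := z.zero_at_infty'
    rw [Filter.cocompact_eq_cofinite] at this
    simpa using this.norm
  have hfin : {j | ¬ ‖z j‖ < 1 / 2}.Finite := by
    have := h0.eventually (gt_mem_nhds (show (0 : ℝ) < 1 / 2 by norm_num))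
    simpa [Filter.eventually_cofinite] using this
  obtain ⟨c, hc0, hc1, hc⟩ : ∃ c : ℝ, 0 ≤ c ∧ c < 1 ∧ ∀ j, ‖z j‖ ≤ c := by
    by_cases hne : {j | ¬ ‖z j‖ < 1 / 2}.Nonempty
    · obtain ⟨i, hi, hmax⟩ := hfin.exists_maximalFor (fun j => ‖z j‖) _ hne
      refine ⟨‖z i‖, norm_nonneg _, h i, fun j => ?_⟩
      by_cases hj : ‖z j‖ < 1 / 2
      · exact hj.le.trans (not_lt.mp hi)
      · rcases le_total ‖z j‖ ‖z i‖ with h1 | h1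
        · exact h1
        · exact hmax hj h1
    · refine ⟨1 / 2, by norm_num, by norm_num, fun j => ?_⟩
      by_contra hj
      exact hne ⟨j, fun h' => hj h'.le⟩
  have hle : ‖z.toBCF‖ ≤ c := (BoundedContinuousFunction.norm_le hc0).2 hc
  simpa [ballB] using (show ‖z‖ ≤ c from hle).trans_lt hc1

/-- The monomial `z^α = ∏_j z_j^{α_j}`, for a finitely supported multi-index `α`. -/
def monom (α : ℕ →₀ ℕ) (z : ballB) : ℂ := α.prod fun j k => z.1 j ^ k

theorem norm_monom_le (α : ℕ →₀ ℕ) (z : ballB) : ‖monom α z‖ ≤ 1 := by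
  rw [monom, Finsupp.prod, norm_prod]
  refine Finset.prod_le_one (fun _ _ => norm_nonneg _) fun j _ => ?_
  rw [norm_pow]
  exact pow_le_one₀ (norm_nonneg _) (norm_coord_lt_one z j).le

/-- `f(z) = ∑_α a_α z^α` for all `z ∈ 𝐁`, with `∑_α |a_α| < ∞`. -/
def IsExpansion (a : (ℕ →₀ ℕ) → ℂ) (f : ballB → ℂ) : Prop :=
  (Summable fun α => ‖a α‖) ∧ ∀ z, f z = ∑' α, a α * monom α z

theorem summable_norm_mul_monom {a : (ℕ →₀ ℕ) → ℂ} (ha : Summable fun α => ‖a α‖) (z : ballB) :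
    Summable fun α => ‖a α * monom α z‖ :=
  ha.of_nonneg_of_le (fun _ => norm_nonneg _) fun α => by
    rw [norm_mul]
    exact mul_le_of_le_one_right (norm_nonneg _) (norm_monom_le α z)

theorem IsExpansion.const (c : ℂ) : IsExpansion (Pi.single 0 c) fun _ => c := by
  refine ⟨summable_of_ne_finset_zero (s := {0}) fun α hα => ?_, fun z => ?_⟩
  · rw [Pi.single_eq_of_ne (by simpa using hα), norm_zero]
  · rw [tsum_eq_single 0 fun α hα => by rw [Pi.single_eq_of_ne hα, zero_mul]]
    simp [monom]

theorem IsExpansion.add {a b : (ℕ →₀ ℕ) → ℂ} {f g : ballB → ℂ} (hf : IsExpansion a f)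
    (hg : IsExpansion b g) : IsExpansion (a + b) (f + g) := by
  refine ⟨(hf.1.add hg.1).of_nonneg_of_le (fun _ => norm_nonneg _) fun α => norm_add_le _ _,
    fun z => ?_⟩
  rw [Pi.add_apply, hf.2, hg.2, ← (summable_norm_mul_monom hf.1 z).of_norm.tsum_add
    (summable_norm_mul_monom hg.1 z).of_norm]
  exact tsum_congr fun α => by rw [Pi.add_apply, add_mul]

theorem IsExpansion.mul {a b : (ℕ →₀ ℕ) → ℂ} {f g : ballB → ℂ} (hf : IsExpansion a f)
    (hg : IsExpansion b g) :
    IsExpansion (fun γ => ∑ p ∈ Finset.HasAntidiagonal.antidiagonal γ, a p.1 * b p.2) (f * g) := by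
  refine ⟨?_, fun z => ?_⟩
  · have h := summable_sum_mul_antidiagonal_of_summable_mul (f := fun α => ‖a α‖)
      (g := fun α => ‖b α‖) (hf.1.mul_of_nonneg hg.1 (fun _ => norm_nonneg _) fun _ => norm_nonneg _)
    refine h.of_nonneg_of_le (fun _ => norm_nonneg _) fun γ => ?_
    exact (norm_sum_le _ _).trans (Finset.sum_le_sum fun p _ => norm_mul_le _ _)
  · have h1 := summable_norm_mul_monom hf.1 z
    have h2 := summable_norm_mul_monom hg.1 z
    have h3 := Summable.tsum_mul_tsum_eq_tsum_sum_antidiagonal (f := fun α => a α * monom α z)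
      (g := fun α => b α * monom α z) h1.of_norm h2.of_norm
      (summable_mul_of_summable_norm (f := fun α => a α * monom α z)
        (g := fun α => b α * monom α z) h1 h2)
    rw [Pi.mul_apply, hf.2, hg.2, h3]
    refine tsum_congr fun γ => ?_
    rw [Finset.sum_mul]
    refine Finset.sum_congr rfl fun p hp => ?_
    have : monom γ z = monom p.1 z * monom p.2 z := by
      rw [← Finset.HasAntidiagonal.mem_antidiagonal.1 hp, monom, monom, monom]
      exact Finsupp.prod_add_index' (fun _ => pow_zero _) fun _ _ _ => pow_add _ _ _
    rw [this]
    ring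

/-- The coefficients of an absolutely convergent expansion are determined by the function on
`𝐁`, so that the norm defined below does not depend on any choice. -/
theorem IsExpansion.unique {a b : (ℕ →₀ ℕ) → ℂ} {f : ballB → ℂ} (ha : IsExpansion a f)
    (hb : IsExpansion b f) : a = b := by
  classical
  set c : (ℕ →₀ ℕ) → ℂ := fun α => a α - b α with hc
  have hcs : Summable fun α => ‖c α‖ :=
    (ha.1.add hb.1).of_nonneg_of_le (fun _ => norm_nonneg _) fun α => norm_sub_le _ _
  have hc0 : ∀ z : ballB, ∑' α, c α * monom α z = 0 := by
    intro z
    have h1 := (summable_norm_mul_monom ha.1 z).of_norm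
    have h2 := (summable_norm_mul_monom hb.1 z).of_norm
    calc ∑' α, c α * monom α z = ∑' α, (a α * monom α z - b α * monom α z) :=
          tsum_congr fun α => by rw [hc]; ring
      _ = 0 := by rw [h1.tsum_sub h2, ← ha.2, ← hb.2, sub_self]
  suffices h : ∀ α, c α = 0 from funext fun α => sub_eq_zero.1 (h α)
  intro α₀
  set S := α₀.support with hS
  set n₀ := α₀.sum (fun _ x => x) with hn₀
  set P : MvPolynomial ℕ ℂ :=
    ∑ α ∈ Finset.finsuppAntidiag S n₀, MvPolynomial.monomial α (c α) with hP
  suffices hP0 : P = 0 by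
    have := congrArg (MvPolynomial.coeff α₀) hP0
    rw [hP, MvPolynomial.coeff_sum, MvPolynomial.coeff_zero] at this
    simp only [MvPolynomial.coeff_monomial] at this
    rw [Finset.sum_ite_eq' , if_pos] at this
    · exact this
    · rw [Finset.mem_finsuppAntidiag']
      exact ⟨rfl, subset_rfl⟩
  refine MvPolynomial.funext fun u => ?_
  rw [map_zero]
  -- the point with coordinates `t u_j` for `j ∈ S`, and `0` elsewhere
  have hM : ∃ M : ℝ, 0 < M ∧ ∀ j ∈ S, ‖u j‖ ≤ M := by
    refine ⟨1 + ∑ j ∈ S, ‖u j‖, by positivity, fun j hj => ?_⟩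
    have := Finset.single_le_sum (f := fun j => ‖u j‖) (fun _ _ => norm_nonneg _) hj
    have h' : ‖u j‖ ≤ ∑ j ∈ S, ‖u j‖ := this
    linarith
  obtain ⟨M, hM0, hM⟩ := hM
  let pt : ℂ → CZero := fun t =>
    { toFun := fun j => if j ∈ S then t * u j else 0
      continuous_toFun := continuous_of_discreteTopology
      zero_at_infty' := by
        rw [Filter.cocompact_eq_cofinite]
        refine tendsto_const_nhds.congr' ?_
        have : ∀ᶠ j in Filter.cofinite, j ∉ S := S.finite_toSet.eventually_cofinite_notMem
        filter_upwards [this] with j hj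
        rw [if_neg hj] }
  have hpt : ∀ t : ℂ, ‖t‖ < 1 / M → pt t ∈ ballB := by
    intro t ht
    rw [mem_ballB_iff]
    intro j
    change ‖(if j ∈ S then t * u j else 0 : ℂ)‖ < 1
    split_ifs with hj
    · rw [norm_mul]
      calc ‖t‖ * ‖u j‖ ≤ ‖t‖ * M := by gcongr; exact hM j hj
        _ < 1 := by rwa [lt_div_iff₀ hM0] at ht
    · simp
  let Q : ℕ → ℂ := fun n => ∑ α ∈ Finset.finsuppAntidiag S n, c α * α.prod fun j k => u j ^ k
  have hmon : ∀ (t : ℂ) (ht : ‖t‖ < 1 / M) (α : ℕ →₀ ℕ), monom α ⟨pt t, hpt t ht⟩ =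
      if α.support ⊆ S then t ^ (α.sum fun _ x => x) * α.prod (fun j k => u j ^ k) else 0 := by
    intro t ht α
    change (α.prod fun j k => (if j ∈ S then t * u j else 0 : ℂ) ^ k) = _
    split_ifs with hα
    · simp only [Finsupp.prod, Finsupp.sum]
      rw [← Finset.prod_pow_eq_pow_sum, ← Finset.prod_mul_distrib]
      refine Finset.prod_congr rfl fun j hj => ?_
      rw [if_pos (hα hj), mul_pow]
    · obtain ⟨j, hj, hjS⟩ := Finset.not_subset.1 hα
      refine Finset.prod_eq_zero hj ?_
      simp only
      rw [if_neg hjS, zero_pow (Finsupp.mem_support_iff.1 hj)]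
  have hQ : ∀ t : ℂ, ‖t‖ < 1 / M → HasSum (fun n => t ^ n * Q n) 0 := by
    intro t ht
    have hsum := (summable_norm_mul_monom hcs ⟨pt t, hpt t ht⟩).of_norm.hasSum
    rw [hc0] at hsum
    have hsum' : HasSum (fun p : (Σ n : ℕ, {α : ℕ →₀ ℕ // (α.sum fun _ x => x) = n}) =>
        c p.2.1 * monom p.2.1 ⟨pt t, hpt t ht⟩) 0 :=
      (Equiv.sigmaFiberEquiv (fun α : ℕ →₀ ℕ => α.sum fun _ x => x)).hasSum_iff.2 hsum
    refine hsum'.sigma fun n => ?_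
    obtain ⟨G, hG1, hG0⟩ : ∃ G : (ℕ →₀ ℕ) → ℂ,
        (∀ α ∈ Finset.finsuppAntidiag S n, G α = t ^ n * (c α * α.prod fun j k => u j ^ k)) ∧
        ∀ α ∉ Finset.finsuppAntidiag S n, G α = 0 :=
      ⟨fun α => if α ∈ Finset.finsuppAntidiag S n then
          t ^ n * (c α * α.prod fun j k => u j ^ k) else 0,
        fun α hα => if_pos hα, fun α hα => if_neg hα⟩
    have hval : ∀ p : {α : ℕ →₀ ℕ // (α.sum fun _ x => x) = n},
        c p.1 * monom p.1 ⟨pt t, hpt t ht⟩ = G p.1 := by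
      rintro ⟨α, hα⟩
      change c α * monom α ⟨pt t, hpt t ht⟩ = G α
      rw [hmon t ht α]
      by_cases hs : α.support ⊆ S
      · rw [if_pos hs, hG1 α (Finset.mem_finsuppAntidiag'.2 ⟨hα, hs⟩), hα]
        ring
      · rw [if_neg hs, hG0 α (fun h => hs (Finset.mem_finsuppAntidiag'.1 h).2), mul_zero]
    have hh : HasSum G (t ^ n * Q n) := by
      have h1 : HasSum G (∑ α ∈ Finset.finsuppAntidiag S n, G α) :=
        hasSum_sum_of_ne_finset_zero hG0
      have h2 : ∑ α ∈ Finset.finsuppAntidiag S n, G α = t ^ n * Q n := by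
        rw [Finset.mul_sum]
        exact Finset.sum_congr rfl hG1
      rwa [h2] at h1
    have hh' : HasSum (fun p : {α : ℕ →₀ ℕ // (α.sum fun _ x => x) = n} => G p.1)
        (t ^ n * Q n) := by
      refine (Function.Injective.hasSum_iff (f := G) Subtype.val_injective fun α hα => ?_).2 hh
      exact hG0 α fun h => hα ⟨⟨α, (Finset.mem_finsuppAntidiag'.1 h).1⟩, rfl⟩
    have hG := funext hval
    rw [← hG] at hh'
    exact hh'
  let p : FormalMultilinearSeries ℂ ℂ ℂ :=
    fun n => ContinuousMultilinearMap.mkPiRing ℂ (Fin n) (Q n)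
  have hp : ∀ n, p.coeff n = Q n := fun n => by
    simp [p, FormalMultilinearSeries.coeff]
  have hps : HasFPowerSeriesAt (fun _ : ℂ => (0 : ℂ)) p 0 := by
    refine hasFPowerSeriesAt_iff.2 ?_
    have : ∀ᶠ t in nhds (0 : ℂ), ‖t‖ < 1 / M := by
      have := Metric.ball_mem_nhds (0 : ℂ) (show 0 < 1 / M by positivity)
      filter_upwards [this] with t ht
      simpa using ht
    filter_upwards [this] with t ht
    simpa only [hp, smul_eq_mul] using hQ t ht
  have hQ0 : Q n₀ = 0 := by
    rw [← hp, hps.eq_zero]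
    rfl
  rw [hP, map_sum, ← hQ0]
  refine Finset.sum_congr rfl fun α _ => ?_
  rw [MvPolynomial.eval_monomial]

/-- The Wiener algebra `A⁺(𝕋^∞)`, with pointwise operations: the functions
`f(z) = ∑_α a_α z^α` with `∑_α |a_α| < ∞`, regarded as functions on `𝐁`. -/
def wienerPlus : Subalgebra ℂ (ballB → ℂ) where
  carrier := {f | ∃ a, IsExpansion a f}
  mul_mem' := by
    rintro f g ⟨a, ha⟩ ⟨b, hb⟩
    exact ⟨_, ha.mul hb⟩
  add_mem' := by
    rintro f g ⟨a, ha⟩ ⟨b, hb⟩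
    exact ⟨_, ha.add hb⟩
  algebraMap_mem' := fun c => ⟨_, IsExpansion.const c⟩

/-- The coefficients `a_α` of `f ∈ A⁺(𝕋^∞)`. -/
def wienerCoeff (f : wienerPlus) : (ℕ →₀ ℕ) → ℂ := Classical.choose f.2

theorem wienerCoeff_spec (f : wienerPlus) : IsExpansion (wienerCoeff f) f.1 :=
  Classical.choose_spec f.2

/-- The norm `‖f‖ = ∑_α |a_α|` of `A⁺(𝕋^∞)`. -/
def wienerNorm (f : wienerPlus) : ℝ := ∑' α, ‖wienerCoeff f α‖

theorem wienerNorm_eq {f : wienerPlus} {a : (ℕ →₀ ℕ) → ℂ} (ha : IsExpansion a f.1) :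
    wienerNorm f = ∑' α, ‖a α‖ := by
  rw [wienerNorm, (wienerCoeff_spec f).unique ha]

/-- Analyticity of a map `φ : 𝐁 → 𝐁`, as a map on an open subset of the Banach space `c₀` with
values in `c₀` (the extension `F` only serves to give `φ` values off `𝐁`). -/
def IsAnalyticSelfMap (φ : ballB → ballB) : Prop :=
  ∃ F : CZero → CZero, AnalyticOnNhd ℂ F ballB ∧ ∀ z : ballB, F z.1 = (φ z).1

/-- `φ` induces a composition operator on `A⁺(𝕋^∞)`: `f ∘ φ ∈ A⁺(𝕋^∞)` for all
`f ∈ A⁺(𝕋^∞)`. -/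
def InducesCompOp (φ : ballB → ballB) : Prop :=
  ∀ f ∈ wienerPlus, f ∘ φ ∈ wienerPlus

/-- The composition operator `C_φ f = f ∘ φ`, an endomorphism of the algebra `A⁺(𝕋^∞)`. -/
def compOp (φ : ballB → ballB) (h : InducesCompOp φ) : wienerPlus →ₐ[ℂ] wienerPlus where
  toFun f := ⟨f.1 ∘ φ, h f.1 f.2⟩
  map_one' := rfl
  map_mul' _ _ := rfl
  map_zero' := rfl
  map_add' _ _ := rfl
  commutes' _ := rfl

end

/-! Through its coefficients the algebra is `ℓ¹` of the multi-indices with convolution as product.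
The norm detects disjointness of spectra: this happens exactly when `‖f ± g‖ = ‖f‖ + ‖g‖` for both
signs (`disjoint_spectrum_iff`). An isometric automorphism and its inverse therefore preserve
disjointness. Nonzero multiples of monomials are the nonzero elements that do not split into two
nonzero disjoint pieces, so they are permuted, with unimodular factors (`exists_map_wienerMonom`).
Multiplicativity then singles out the coordinates as the irreducible monomials (`exists_map_coord`).
For `C_φ`, the image of the `j`-th coordinate is `φ_j`, which gives the formula; the inverse
automorphism supplies the inverse permutation. -/

/-! ### Coefficients and monomials -/

theorem wienerCoeff_eq {f : wienerPlus} {a : (ℕ →₀ ℕ) → ℂ}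
    (ha : IsExpansion a f.1) : wienerCoeff f = a :=
  (wienerCoeff_spec f).unique ha

theorem wienerCoeff_injective : Function.Injective wienerCoeff := fun f g h =>
  Subtype.ext <| funext fun z => by
    rw [(wienerCoeff_spec f).2, (wienerCoeff_spec g).2, h]

theorem wienerCoeff_add (f g : wienerPlus) :
    wienerCoeff (f + g) = wienerCoeff f + wienerCoeff g :=
  wienerCoeff_eq ((wienerCoeff_spec f).add (wienerCoeff_spec g))

theorem wienerCoeff_smul (c : ℂ) (f : wienerPlus) :
    wienerCoeff (c • f) = c • wienerCoeff f := by
  refine wienerCoeff_eq ⟨?_, fun z => ?_⟩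
  · simpa only [Pi.smul_apply, norm_smul] using (wienerCoeff_spec f).1.mul_left ‖c‖
  · change c * f.1 z = _
    rw [(wienerCoeff_spec f).2, ← tsum_mul_left]
    exact tsum_congr fun α => (mul_assoc _ _ _).symm

theorem wienerCoeff_zero : wienerCoeff 0 = 0 := by
  simpa using wienerCoeff_smul 0 0

theorem wienerCoeff_sub (f g : wienerPlus) :
    wienerCoeff (f - g) = wienerCoeff f - wienerCoeff g := by
  have h : f - g = f + (-1 : ℂ) • g := by rw [neg_one_smul, sub_eq_add_neg]
  rw [h, wienerCoeff_add, wienerCoeff_smul, neg_one_smul, sub_eq_add_neg]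

/-- The monomial `z^α`, as an element of the Wiener algebra. -/
noncomputable def wienerMonom (α : ℕ →₀ ℕ) : wienerPlus :=
  ⟨monom α, Pi.single α 1, by
    refine ⟨summable_of_ne_finset_zero (s := {α}) fun β hβ => ?_, fun z => ?_⟩
    · rw [Pi.single_eq_of_ne (by simpa using hβ), norm_zero]
    · rw [tsum_eq_single α fun β hβ => by rw [Pi.single_eq_of_ne hβ, zero_mul]]
      simp⟩

theorem wienerCoeff_wienerMonom (α : ℕ →₀ ℕ) : wienerCoeff (wienerMonom α) = Pi.single α 1 := by
  refine wienerCoeff_eq ⟨?_, fun z => ?_⟩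
  · refine summable_of_ne_finset_zero (s := {α}) fun β hβ => ?_
    rw [Pi.single_eq_of_ne (by simpa using hβ), norm_zero]
  · rw [tsum_eq_single α fun β hβ => by rw [Pi.single_eq_of_ne hβ, zero_mul]]
    simp [wienerMonom]

theorem wienerMonom_zero : wienerMonom 0 = 1 :=
  Subtype.ext <| funext fun z => by simp [wienerMonom, monom]

theorem wienerMonom_add (α β : ℕ →₀ ℕ) :
    wienerMonom (α + β) = wienerMonom α * wienerMonom β :=
  Subtype.ext <| funext fun _ =>
    Finsupp.prod_add_index' (fun _ => pow_zero _) fun _ _ _ => pow_add _ _ _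

theorem wienerMonom_single_apply (j : ℕ) (z : ballB) :
    (wienerMonom (Finsupp.single j 1)).1 z = z.1 j := by
  simp [wienerMonom, monom]

theorem wienerNorm_smul_wienerMonom (c : ℂ) (α : ℕ →₀ ℕ) :
    wienerNorm (c • wienerMonom α) = ‖c‖ := by
  rw [wienerNorm, wienerCoeff_smul, wienerCoeff_wienerMonom,
    tsum_eq_single α fun β hβ => by simp [Pi.single_eq_of_ne hβ]]
  simp

theorem smul_wienerMonom_inj {c d : ℂ} {α β : ℕ →₀ ℕ} (hc : c ≠ 0)
    (h : c • wienerMonom α = d • wienerMonom β) : α = β := by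
  by_contra hne
  have h' := congrFun (congrArg wienerCoeff h) α
  simp [wienerCoeff_smul, wienerCoeff_wienerMonom, Pi.single_eq_of_ne hne, hc] at h'

/-! ### Disjoint spectra -/

/-- The parallelogram law turns the two equalities into `(‖a‖ + ‖b‖)² = ‖a‖² + ‖b‖²`. -/
theorem eq_zero_or_eq_zero_of_norm_add_of_norm_sub {a b : ℂ} (h₁ : ‖a + b‖ = ‖a‖ + ‖b‖)
    (h₂ : ‖a - b‖ = ‖a‖ + ‖b‖) : a = 0 ∨ b = 0 := by
  have h := parallelogram_law_with_norm ℝ a b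
  rw [h₁, h₂] at h
  have : ‖a‖ * ‖b‖ = 0 := by linarith
  simpa using this

/-- Two elements of the Wiener algebra have disjoint spectra if and only if the triangle
inequality is an equality for their sum and for their difference. -/
theorem disjoint_spectrum_iff (f g : wienerPlus) :
    (∀ α, wienerCoeff f α = 0 ∨ wienerCoeff g α = 0) ↔
      wienerNorm (f + g) = wienerNorm f + wienerNorm g ∧
        wienerNorm (f - g) = wienerNorm f + wienerNorm g := by
  have hf := (wienerCoeff_spec f).1
  have hg := (wienerCoeff_spec g).1
  have hadd : Summable fun α => ‖wienerCoeff f α + wienerCoeff g α‖ := by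
    simpa [wienerCoeff_add] using (wienerCoeff_spec (f + g)).1
  have hsub : Summable fun α => ‖wienerCoeff f α - wienerCoeff g α‖ := by
    simpa [wienerCoeff_sub] using (wienerCoeff_spec (f - g)).1
  -- Equality of the sums forces equality of all terms, since a single strict inequality would make
  -- the sum strictly smaller.
  have pointwise : ∀ {u : (ℕ →₀ ℕ) → ℝ}, Summable u →
      (∀ α, u α ≤ ‖wienerCoeff f α‖ + ‖wienerCoeff g α‖) →
      ∑' α, u α = ∑' α, (‖wienerCoeff f α‖ + ‖wienerCoeff g α‖) →
      ∀ α, u α = ‖wienerCoeff f α‖ + ‖wienerCoeff g α‖ := by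
    intro u hu hle heq α
    by_contra hne
    exact (hu.tsum_lt_tsum (i := α) hle (lt_of_le_of_ne (hle α) hne) (hf.add hg)).ne heq
  simp only [wienerNorm, wienerCoeff_add, wienerCoeff_sub, Pi.add_apply, Pi.sub_apply]
  rw [← hf.tsum_add hg]
  constructor
  · intro h
    constructor <;> refine tsum_congr fun α => ?_ <;> rcases h α with h | h <;> simp [h]
  · rintro ⟨h₁, h₂⟩ α
    exact eq_zero_or_eq_zero_of_norm_add_of_norm_sub
      (pointwise hadd (fun _ => norm_add_le _ _) h₁ α)
      (pointwise hsub (fun _ => norm_sub_le _ _) h₂ α)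

/-- Monomials are atoms: away from `α` the two coefficients add up to zero and one of them vanishes,
so both do. -/
theorem eq_zero_of_add_eq_wienerMonom {f g : wienerPlus} {α : ℕ →₀ ℕ}
    (hd : ∀ β, wienerCoeff f β = 0 ∨ wienerCoeff g β = 0) (h : f + g = wienerMonom α)
    (hα : wienerCoeff f α = 0) : f = 0 := by
  refine wienerCoeff_injective (funext fun β => ?_)
  rw [wienerCoeff_zero, Pi.zero_apply]
  rcases eq_or_ne β α with rfl | hne
  · exact hα
  rcases hd β with h0 | h0
  · exact h0
  have h' := congrFun (congrArg wienerCoeff h) β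
  simpa [wienerCoeff_add, wienerCoeff_wienerMonom, Pi.single_eq_of_ne hne, h0] using h'

/-! ### Isometric automorphisms acting on monomials -/

section Isometry

variable {T : wienerPlus ≃ₐ[ℂ] wienerPlus}

theorem wienerNorm_symm_apply (hT : ∀ f, wienerNorm (T f) = wienerNorm f) (f : wienerPlus) :
    wienerNorm (T.symm f) = wienerNorm f := by
  rw [← hT, T.apply_symm_apply]

/-- An isometric automorphism preserves disjointness of spectra, hence maps monomials to
unimodular multiples of monomials. -/
theorem exists_map_wienerMonom (hT : ∀ f, wienerNorm (T f) = wienerNorm f) (α : ℕ →₀ ℕ) :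
    ∃ (c : ℂ) (β : ℕ →₀ ℕ), ‖c‖ = 1 ∧ T (wienerMonom α) = c • wienerMonom β := by
  suffices h : ∃ (c : ℂ) (β : ℕ →₀ ℕ), T (wienerMonom α) = c • wienerMonom β by
    obtain ⟨c, β, h⟩ := h
    refine ⟨c, β, ?_, h⟩
    rw [← wienerNorm_smul_wienerMonom c β, ← h, hT, ← one_smul ℂ (wienerMonom α),
      wienerNorm_smul_wienerMonom, norm_one]
  set f := T (wienerMonom α) with hf
  obtain ⟨β, hβ⟩ : ∃ β, wienerCoeff f β ≠ 0 := by
    by_contra! h0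
    have hf0 : T (wienerMonom α) = T 0 := by
      rw [map_zero, ← hf]
      exact wienerCoeff_injective (by rw [wienerCoeff_zero]; exact funext h0)
    have := congrFun (congrArg wienerCoeff (T.injective hf0)) α
    simp [wienerCoeff_wienerMonom, wienerCoeff_zero] at this
  -- Split off one nonzero term of `f`. Pulled back by `T`, the pieces `g` and `f - g` decompose a
  -- monomial disjointly, so one of them is zero; it cannot be `g`.
  set g := wienerCoeff f β • wienerMonom β with hg
  have hgβ : wienerCoeff g β = wienerCoeff f β := by
    simp [hg, wienerCoeff_smul, wienerCoeff_wienerMonom]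
  have hd : ∀ γ, wienerCoeff g γ = 0 ∨ wienerCoeff (f - g) γ = 0 := by
    intro γ
    rcases eq_or_ne γ β with rfl | hne
    · right
      rw [wienerCoeff_sub, Pi.sub_apply, hgβ, sub_self]
    · left
      simp [hg, wienerCoeff_smul, wienerCoeff_wienerMonom, Pi.single_eq_of_ne hne]
  have hd' : ∀ γ, wienerCoeff (T.symm g) γ = 0 ∨ wienerCoeff (T.symm (f - g)) γ = 0 := by
    rw [disjoint_spectrum_iff] at hd ⊢
    simpa only [← map_add, ← map_sub, wienerNorm_symm_apply hT] using hd
  have hsum : T.symm g + T.symm (f - g) = wienerMonom α := by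
    rw [← map_add, add_sub_cancel, hf, T.symm_apply_apply]
  refine ⟨wienerCoeff f β, β, ?_⟩
  rcases hd' α with h0 | h0
  · have hz := eq_zero_of_add_eq_wienerMonom hd' hsum h0
    rw [map_eq_zero_iff _ T.symm.injective] at hz
    rw [hz, wienerCoeff_zero] at hgβ
    exact absurd hgβ.symm hβ
  · have hz := eq_zero_of_add_eq_wienerMonom (fun γ => (hd' γ).symm)
      (by rw [add_comm]; exact hsum) h0
    rw [map_eq_zero_iff _ T.symm.injective] at hz
    exact sub_eq_zero.1 hz

/-- An isometric automorphism maps coordinate functions to unimodular multiples of coordinate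
functions, because these are the monomials which are irreducible. -/
theorem exists_map_coord (hT : ∀ f, wienerNorm (T f) = wienerNorm f) (j : ℕ) :
    ∃ (c : ℂ) (k : ℕ), ‖c‖ = 1 ∧
      T (wienerMonom (Finsupp.single j 1)) = c • wienerMonom (Finsupp.single k 1) := by
  obtain ⟨c, β, hc, h⟩ := exists_map_wienerMonom hT (Finsupp.single j 1)
  have hc0 : c ≠ 0 := norm_ne_zero_iff.1 (by simp [hc])
  -- Constants are fixed by `T`, so only the constant monomial can be pulled back to a constant.
  have symm_const : ∀ {d : ℂ} {γ : ℕ →₀ ℕ}, T.symm (wienerMonom γ) = d • wienerMonom 0 →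
      γ = 0 := by
    intro d γ hγ
    rw [AlgEquiv.symm_apply_eq, map_smul, wienerMonom_zero, map_one, ← wienerMonom_zero,
      ← one_smul ℂ (wienerMonom γ)] at hγ
    exact smul_wienerMonom_inj one_ne_zero hγ
  have hβ : β ≠ 0 := by
    rintro rfl
    have h' : T.symm (c • wienerMonom 0) = wienerMonom (Finsupp.single j 1) := by
      rw [← h, T.symm_apply_apply]
    rw [map_smul, wienerMonom_zero, map_one, ← wienerMonom_zero,
      ← one_smul ℂ (wienerMonom (Finsupp.single j 1))] at h'
    exact (Finsupp.single_ne_zero.2 one_ne_zero) (smul_wienerMonom_inj hc0 h').symm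
  obtain ⟨k, hk⟩ := Finsupp.support_nonempty_iff.2 hβ
  have hkβ : Finsupp.single k 1 ≤ β := by
    rw [Finsupp.single_le_iff]
    exact Nat.one_le_iff_ne_zero.2 (Finsupp.mem_support_iff.1 hk)
  -- Factor one variable out of the image; pulling back both factors factors the `j`-th coordinate.
  obtain ⟨γ, rfl⟩ := exists_add_of_le hkβ
  obtain ⟨d₁, γ₁, -, h₁⟩ := exists_map_wienerMonom (wienerNorm_symm_apply hT) (Finsupp.single k 1)
  obtain ⟨d₂, γ₂, -, h₂⟩ := exists_map_wienerMonom (wienerNorm_symm_apply hT) γ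
  have hsplit : (1 : ℂ) • wienerMonom (Finsupp.single j 1) =
      (c * (d₁ * d₂)) • wienerMonom (γ₁ + γ₂) := by
    rw [one_smul, ← T.symm_apply_apply (wienerMonom (Finsupp.single j 1)), h, map_smul,
      wienerMonom_add, map_mul, h₁, h₂, smul_mul_smul_comm, ← wienerMonom_add, smul_smul]
  have hj := smul_wienerMonom_inj one_ne_zero hsplit
  have hγ₁ : γ₁ ≠ 0 := by
    rintro rfl
    simpa using symm_const h₁
  -- The degrees of `γ₁` and `γ₂` add up to 1, and that of `γ₁` is already positive.
  have hγ₂ : γ₂ = 0 := by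
    have hdeg := congrArg Finsupp.degree hj
    rw [map_add, Finsupp.degree_single] at hdeg
    have : Finsupp.degree γ₁ ≠ 0 := by rwa [Ne, Finsupp.degree_eq_zero_iff]
    rw [← Finsupp.degree_eq_zero_iff]
    omega
  subst hγ₂
  obtain rfl := symm_const h₂
  exact ⟨c, k, hc, by rw [h, add_zero]⟩

/-- If `T` sends each coordinate to a multiple of a coordinate, then so does its inverse, with the
inverse map on indices. -/
theorem leftInverse_of_map_coord {S : wienerPlus ≃ₐ[ℂ] wienerPlus} {c d : ℕ → ℂ} {s t : ℕ → ℕ}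
    (hS : ∀ f, S (T f) = f)
    (hs : ∀ j, T (wienerMonom (Finsupp.single j 1)) = c j • wienerMonom (Finsupp.single (s j) 1))
    (ht : ∀ j, S (wienerMonom (Finsupp.single j 1)) = d j • wienerMonom (Finsupp.single (t j) 1)) :
    Function.LeftInverse t s := by
  intro j
  have h := hS (wienerMonom (Finsupp.single j 1))
  rw [hs, map_smul, ht, smul_smul, ← one_smul ℂ (wienerMonom (Finsupp.single j 1))] at h
  exact (Finsupp.single_left_injective one_ne_zero
    (smul_wienerMonom_inj one_ne_zero h.symm)).symm

end Isometry

theorem theorem4p5 (φ : ballB → ballB) (hφ : IsAnalyticSelfMap φ) (hC : InducesCompOp φ)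
    (haut : Function.Bijective (compOp φ hC))
    (hiso : ∀ f : wienerPlus, wienerNorm (compOp φ hC f) = wienerNorm f) :
    ∃ (σ : Equiv.Perm ℕ) (ε : ℕ → ℂ), (∀ j, ‖ε j‖ = 1) ∧
      ∀ (z : ballB) (j : ℕ), (φ z).1 j = ε j * z.1 (σ j) := by
  let T : wienerPlus ≃ₐ[ℂ] wienerPlus := AlgEquiv.ofBijective (compOp φ hC) haut
  have hT : ∀ f, wienerNorm (T f) = wienerNorm f := hiso
  choose ε s hε hs using exists_map_coord hT
  choose d t _ ht using exists_map_coord (wienerNorm_symm_apply hT)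
  refine ⟨⟨s, t, leftInverse_of_map_coord T.symm_apply_apply hs ht,
    leftInverse_of_map_coord T.apply_symm_apply ht hs⟩, ε, hε, fun z j => ?_⟩
  -- `T` is composition with `φ`, so the left side at `z` is the `j`-th coordinate function at `φ
  -- z`.
  have h := congrFun (congrArg Subtype.val (hs j)) z
  calc (φ z).1 j = (wienerMonom (Finsupp.single j 1)).1 (φ z) :=
        (wienerMonom_single_apply j _).symm
    _ = ε j * (wienerMonom (Finsupp.single (s j) 1)).1 z := h
    _ = ε j * z.1 (s j) := by rw [wienerMonom_single_apply]
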